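/- For a group $G$, let $S(G)$ be the group of permutations of the set $G$, let $\rho(G)\le S(G)$ be the image of the right regular representation (the permutations $x\mapsto xy$ with $y\in G$), and put \[ \mathrm{Hol}(G)=N_{S(G)}(\rho(G)),\qquad \mathrm{NHol}(G)=N_{S(G)}(\mathrm{Hol}(G)),\qquad T(G)=\mathrm{NHol}(G)/\mathrm{Hol}(G). \] Let $p$ be any odd prime and let $H$ be any finite group. Then for all sufficiently large integers $n$, there exists a finite $p$-group $G$ of nilpotency class two and of order $p^{\,n+\binom{n}{2}}$ such that $H$ embeds into $T(G)$, that is, there is an injective group homomorphism $H\to T(G)$. -/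

import Mathlib

/-- The image `ρ(G)` of the right regular representation of `G`, as a subgroup of the group of
permutations of the set `G`: the permutations `x ↦ x * y` for `y` in `G`. -/
def rightRegular (G : Type*) [Group G] : Subgroup (Equiv.Perm G) where
  carrier := {σ | ∃ y : G, ∀ x : G, σ x = x * y}
  mul_mem' := by
    rintro σ τ ⟨y, hy⟩ ⟨z, hz⟩
    exact ⟨z * y, fun x => by rw [Equiv.Perm.mul_apply, hz, hy, mul_assoc]⟩
  one_mem' := ⟨1, fun x => by simp⟩
  inv_mem' := by
    rintro σ ⟨y, hy⟩
    exact ⟨y⁻¹, fun x => by rw [Equiv.Perm.inv_eq_iff_eq, hy, inv_mul_cancel_right]⟩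

/-- The holomorph `Hol(G)`: the normalizer of `ρ(G)` in the group of permutations of `G`. -/
def holomorph (G : Type*) [Group G] : Subgroup (Equiv.Perm G) :=
  Subgroup.normalizer (rightRegular G : Set (Equiv.Perm G))

/-- The multiple holomorph `NHol(G)`: the normalizer of `Hol(G)` in the group of permutations
of `G`. -/
def multipleHolomorph (G : Type*) [Group G] : Subgroup (Equiv.Perm G) :=
  Subgroup.normalizer (holomorph G : Set (Equiv.Perm G))

/-- `Hol(G)`, viewed as a subgroup of `NHol(G)`, is normal there. -/
instance holomorph_normal (G : Type*) [Group G] :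
    ((holomorph G).subgroupOf (multipleHolomorph G)).Normal :=
  Subgroup.normal_in_normalizer

/-- The quotient group `T(G) = NHol(G) / Hol(G)`. -/
abbrev TGroup (G : Type*) [Group G] : Type _ :=
  multipleHolomorph G ⧸ (holomorph G).subgroupOf (multipleHolomorph G)

/-! Let a class-two group be built from an alternating map `β` on `V` with values in `Z`. An
automorphism of `Z`, applied to the second coordinate only, normalizes `Hol` once it commutes with
every `k` that group automorphisms induce on `Z`; it lies in `Hol` only if it fixes all values of
`β`. So if every `k` is scalar and `β` spans `Z`, then `H`, permuting the coordinates of `Z`, embeds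
into `T` (`exists_injective_hom_TGroup`).

Radicals force `k` to be scalar (`exists_smul_of_blockForm_comp`). Take `β` to be an orthogonal sum
of symplectic planes with values on the lines of a frame: the standard basis and its sum. If the
multiplicities of these lines have distinct subset sums, the size of the radical of `f ∘ β` tells
which frame vectors a functional `f` kills. Hence `k` preserves each frame line. -/

/-! ### The holomorph as automorphisms followed by translations -/

theorem mem_holomorph_iff {G : Type*} [Group G] (σ : Equiv.Perm G) :
    σ ∈ holomorph G ↔ ∃ (α : G ≃* G) (y : G), ∀ x, σ x = α x * y := by
  constructor
  · intro h
    -- Conjugation by `σ` turns right multiplication by `w` into that by some `w'`, which evaluation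
    -- at `1` identifies.
    have key (x w : G) : σ (x * w) = σ x * (σ 1)⁻¹ * σ w := by
      have hw : Equiv.mulRight w ∈ rightRegular G := ⟨w, fun _ => rfl⟩
      obtain ⟨w', hw'⟩ := (Subgroup.mem_normalizer_iff.1 h _).1 hw
      have h1 (x : G) : σ (x * w) = σ x * w' := by simpa using hw' (σ x)
      have h2 : σ w = σ 1 * w' := by simpa using h1 1
      rw [h1, h2, mul_assoc, inv_mul_cancel_left]
    refine ⟨MulEquiv.mk' (σ.trans (Equiv.mulRight (σ 1)⁻¹)) fun x y => ?_, σ 1, fun x => ?_⟩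
    · change σ (x * y) * (σ 1)⁻¹ = σ x * (σ 1)⁻¹ * (σ y * (σ 1)⁻¹)
      simp [key x y, mul_assoc]
    · exact (inv_mul_cancel_right (σ x) (σ 1)).symm
  · rintro ⟨α, y, h⟩
    have hinv (x : G) : α (σ⁻¹ x) = x * y⁻¹ := by
      rw [eq_mul_inv_iff_mul_eq, ← h]; exact σ.apply_symm_apply x
    refine Subgroup.mem_normalizer_iff.2 fun τ => ⟨?_, ?_⟩
    · rintro ⟨w, hw⟩
      exact ⟨y⁻¹ * α w * y, fun x => by
        rw [Equiv.Perm.mul_apply, Equiv.Perm.mul_apply, hw, h, map_mul, hinv]; simp [mul_assoc]⟩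
    · rintro ⟨w, hw⟩
      refine ⟨α.symm (y * w * y⁻¹), fun x => ?_⟩
      have : σ (τ x) = σ x * w := by simpa using hw (σ x)
      apply σ.injective
      rw [this, h, h]
      simp [mul_assoc]

/-! ### Central extensions by a biadditive cocycle -/

/-- The central extension of `V` by `Z` with a biadditive cocycle `β`. -/
@[ext]
structure BiaddExt {V Z : Type*} [AddCommGroup V] [AddCommGroup Z] (β : V →+ V →+ Z) where
  fst : V
  snd : Z

namespace BiaddExt

variable {V Z : Type*} [AddCommGroup V] [AddCommGroup Z] {β : V →+ V →+ Z}

instance : Mul (BiaddExt β) := ⟨fun x y => ⟨x.fst + y.fst, x.snd + y.snd + β x.fst y.fst⟩⟩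
instance : One (BiaddExt β) := ⟨⟨0, 0⟩⟩
instance : Inv (BiaddExt β) := ⟨fun x => ⟨-x.fst, -x.snd + β x.fst x.fst⟩⟩

@[simp] theorem fst_mul (x y : BiaddExt β) : (x * y).fst = x.fst + y.fst := rfl
@[simp] theorem snd_mul (x y : BiaddExt β) :
    (x * y).snd = x.snd + y.snd + β x.fst y.fst := rfl
@[simp] theorem fst_one : (1 : BiaddExt β).fst = 0 := rfl
@[simp] theorem snd_one : (1 : BiaddExt β).snd = 0 := rfl
@[simp] theorem fst_inv (x : BiaddExt β) : x⁻¹.fst = -x.fst := rfl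
@[simp] theorem snd_inv (x : BiaddExt β) : x⁻¹.snd = -x.snd + β x.fst x.fst := rfl

instance : Group (BiaddExt β) :=
  Group.ofLeftAxioms
    (fun x y z => by
      ext
      · simp [add_assoc]
      · simp only [snd_mul, fst_mul, map_add, AddMonoidHom.add_apply]; abel)
    (fun x => by ext <;> simp)
    (fun x => by ext <;> simp)

/-- The underlying set of the extension. -/
def equivProd : BiaddExt β ≃ V × Z where
  toFun x := (x.fst, x.snd)
  invFun x := ⟨x.1, x.2⟩
  left_inv _ := rfl
  right_inv _ := rfl

theorem natCard_eq : Nat.card (BiaddExt β) = Nat.card V * Nat.card Z := by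
  rw [Nat.card_congr equivProd, Nat.card_prod]

instance [Finite V] [Finite Z] : Finite (BiaddExt β) := Finite.of_equiv _ equivProd.symm

theorem map_swap (alt : ∀ v, β v v = 0) (v w : V) : β v w = -β w v := by
  have h := alt (v + w)
  simp only [map_add, AddMonoidHom.add_apply, alt, zero_add, add_zero] at h
  rwa [add_comm, ← eq_neg_iff_add_eq_zero] at h

/-- An alternating `β` is antisymmetric, so the two products differ by `2 β`. -/
theorem commute_iff (alt : ∀ v, β v v = 0) (two : ∀ z : Z, z + z = 0 → z = 0)
    (x y : BiaddExt β) : x * y = y * x ↔ β x.fst y.fst = 0 := by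
  constructor
  · intro h
    have h := congrArg snd h
    simp only [snd_mul, map_swap alt y.fst] at h
    apply two
    rw [add_comm y.snd, add_right_inj] at h
    nth_rewrite 1 [h]
    simp
  · intro h
    ext
    · simp [add_comm]
    · simp [h, map_swap alt y.fst, add_comm]

theorem mem_center_iff (alt : ∀ v, β v v = 0) (two : ∀ z : Z, z + z = 0 → z = 0)
    (nondeg : ∀ v, (∀ w, β v w = 0) → v = 0) (x : BiaddExt β) :
    x ∈ Subgroup.center (BiaddExt β) ↔ x.fst = 0 := by
  rw [Subgroup.mem_center_iff]
  constructor
  · intro h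
    exact nondeg _ fun w => (commute_iff alt two x ⟨w, 0⟩).1 (h _).symm
  · intro h y
    exact ((commute_iff alt two x y).2 (by simp [h])).symm

theorem upperCentralSeries_two (alt : ∀ v, β v v = 0) (two : ∀ z : Z, z + z = 0 → z = 0)
    (nondeg : ∀ v, (∀ w, β v w = 0) → v = 0) :
    Subgroup.upperCentralSeries (BiaddExt β) 2 = ⊤ := by
  refine (Subgroup.eq_top_iff' _).2 fun x => ?_
  rw [Subgroup.mem_upperCentralSeries_succ_iff]
  intro y
  rw [Subgroup.upperCentralSeries_one, mem_center_iff alt two nondeg]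
  simp [commutatorElement_def]

theorem isNilpotent (alt : ∀ v, β v v = 0) (two : ∀ z : Z, z + z = 0 → z = 0)
    (nondeg : ∀ v, (∀ w, β v w = 0) → v = 0) : Group.IsNilpotent (BiaddExt β) :=
  ⟨2, upperCentralSeries_two alt two nondeg⟩

theorem nilpotencyClass_eq_two [Nontrivial V] [Group.IsNilpotent (BiaddExt β)]
    (alt : ∀ v, β v v = 0)
    (two : ∀ z : Z, z + z = 0 → z = 0) (nondeg : ∀ v, (∀ w, β v w = 0) → v = 0) :
    Group.nilpotencyClass (BiaddExt β) = 2 := by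
  refine le_antisymm (Subgroup.upperCentralSeries_eq_top_iff_nilpotencyClass_le.1
    (upperCentralSeries_two alt two nondeg)) ?_
  by_contra! h
  have h1 := Subgroup.upperCentralSeries_eq_top_iff_nilpotencyClass_le.2 (Nat.le_of_lt_succ h)
  rw [Subgroup.upperCentralSeries_one] at h1
  obtain ⟨v, hv⟩ := exists_ne (0 : V)
  exact hv ((mem_center_iff alt two nondeg ⟨v, 0⟩).1 (h1 ▸ Subgroup.mem_top _))

/-- An automorphism of the extension is built from additive automorphisms of `V` and `Z` that are
compatible with `β`, and an additive map `V →+ Z`. -/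
theorem exists_of_mulEquiv (alt : ∀ v, β v v = 0) (two : ∀ z : Z, z + z = 0 → z = 0)
    (nondeg : ∀ v, (∀ w, β v w = 0) → v = 0) (α : BiaddExt β ≃* BiaddExt β) :
    ∃ (g : V ≃+ V) (k : Z ≃+ Z) (q : V →+ Z), (∀ v w, k (β v w) = β (g v) (g w)) ∧
      ∀ x, α x = ⟨g x.fst, k x.snd + q x.fst⟩ := by
  have central (α : BiaddExt β ≃* BiaddExt β) (z : Z) : (α ⟨0, z⟩).fst = 0 := by
    have hz := (mem_center_iff alt two nondeg ⟨0, z⟩).2 rfl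
    rw [← mem_center_iff alt two nondeg]
    exact (MulEquivClass.apply_mem_center_iff α).2 hz
  have split (x : BiaddExt β) : x = ⟨x.fst, 0⟩ * ⟨0, x.snd⟩ := by ext <;> simp
  have fst_map (α : BiaddExt β ≃* BiaddExt β) (x : BiaddExt β) :
      (α x).fst = (α ⟨x.fst, 0⟩).fst := by
    conv_lhs => rw [split x, map_mul, fst_mul, central, add_zero]
  let g : V ≃+ V :=
    { toFun v := (α ⟨v, 0⟩).fst
      invFun v := (α.symm ⟨v, 0⟩).fst
      left_inv v := by dsimp only; rw [← fst_map α.symm (α ⟨v, 0⟩)]; simp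
      right_inv v := by dsimp only; rw [← fst_map α (α.symm ⟨v, 0⟩)]; simp
      map_add' v w := by rw [← fst_mul, ← map_mul, fst_map α (_ * _)]; simp }
  have eta (α : BiaddExt β ≃* BiaddExt β) (z : Z) : (⟨0, (α ⟨0, z⟩).snd⟩ : BiaddExt β) =
      α ⟨0, z⟩ := by ext <;> simp [central]
  let k : Z ≃+ Z :=
    { toFun z := (α ⟨0, z⟩).snd
      invFun z := (α.symm ⟨0, z⟩).snd
      left_inv z := by dsimp only; rw [eta α]; simp
      right_inv z := by dsimp only; rw [eta α.symm]; simp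
      map_add' z y := by
        have : (⟨0, z + y⟩ : BiaddExt β) = ⟨0, z⟩ * ⟨0, y⟩ := by ext <;> simp
        rw [this, map_mul]; simp [central] }
  have hα (x : BiaddExt β) : α x = ⟨g x.fst, k x.snd + (α ⟨x.fst, 0⟩).snd⟩ := by
    conv_lhs => rw [split x, map_mul]
    ext
    · simp [g, central]
    · simp [k, central, add_comm]
  have hq (v w : V) : k (β v w) + (α ⟨v + w, 0⟩).snd =
      (α ⟨v, 0⟩).snd + (α ⟨w, 0⟩).snd + β (g v) (g w) := by
    have h := congrArg snd (map_mul α ⟨v, 0⟩ ⟨w, 0⟩)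
    rw [hα (_ * _)] at h
    simpa [g] using h
  have hk (v w : V) : k (β v w) = β (g v) (g w) := by
    -- Exchanging `v` and `w` flips the sign of both `β` terms and nothing else; subtracting leaves
    -- twice the desired identity.
    have h1 := hq v w
    have h2 := hq w v
    rw [map_swap alt w v, map_swap alt (g w), map_neg, add_comm w v] at h2
    rw [← sub_eq_zero]
    apply two
    rw [← sub_eq_zero] at h1 h2
    rw [← sub_eq_zero.2 (h1.trans h2.symm)]
    abel
  refine ⟨g, k, AddMonoidHom.mk' (fun v => (α ⟨v, 0⟩).snd) fun v w => ?_, hk, hα⟩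
  have := hq v w
  rw [hk, add_comm] at this
  exact add_right_cancel this

/-- The permutation of the extension induced by an additive automorphism of `Z`. -/
def permOfAddEquiv (h : Z ≃+ Z) : Equiv.Perm (BiaddExt β) where
  toFun x := ⟨x.fst, h x.snd⟩
  invFun x := ⟨x.fst, h.symm x.snd⟩
  left_inv x := by simp
  right_inv x := by simp

/-- Conjugation leaves `g` and, by `comm`, `k` unchanged. Only the additive map `V →+ Z` has to be
corrected. -/
theorem conj_mem_holomorph (alt : ∀ v, β v v = 0) (two : ∀ z : Z, z + z = 0 → z = 0)
    (nondeg : ∀ v, (∀ w, β v w = 0) → v = 0) (h : Z ≃+ Z)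
    (comm : ∀ (g : V ≃+ V) (k : Z ≃+ Z), (∀ v w, k (β v w) = β (g v) (g w)) →
      ∀ z, k (h z) = h (k z))
    {σ : Equiv.Perm (BiaddExt β)} (hσ : σ ∈ holomorph (BiaddExt β)) :
    permOfAddEquiv h * σ * (permOfAddEquiv h)⁻¹ ∈ holomorph (BiaddExt β) := by
  obtain ⟨α, y, hα⟩ := (mem_holomorph_iff σ).1 hσ
  obtain ⟨g, k, q, hgk, hαx⟩ := exists_of_mulEquiv alt two nondeg α
  have comm' (z : Z) : h (k (h.symm z)) = k z := by rw [← comm g k hgk]; simp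
  -- The correction absorbs the failure of `h` to fix the cocycle term `β (g v) y.fst`.
  let q' : V →+ Z := h.toAddMonoidHom.comp (q + (β.flip y.fst).comp g.toAddMonoidHom) -
    (β.flip y.fst).comp g.toAddMonoidHom
  have hq' (v : V) : q' v = h (q v + β (g v) y.fst) - β (g v) y.fst := rfl
  let α' : BiaddExt β ≃* BiaddExt β :=
    { toFun x := ⟨g x.fst, k x.snd + q' x.fst⟩
      invFun x := ⟨g.symm x.fst, k.symm (x.snd - q' (g.symm x.fst))⟩
      left_inv x := by simp
      right_inv x := by simp
      map_mul' x y := by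
        ext
        · simp
        · simp only [snd_mul, fst_mul, map_add, hgk]; abel }
  refine (mem_holomorph_iff _).2 ⟨α', ⟨y.fst, h y.snd⟩, fun x => ?_⟩
  have hinv : (permOfAddEquiv h)⁻¹ x = ⟨x.fst, h.symm x.snd⟩ := rfl
  have hval (x : BiaddExt β) : permOfAddEquiv h x = ⟨x.fst, h x.snd⟩ := rfl
  have hα' (x : BiaddExt β) : α' x = ⟨g x.fst, k x.snd + q' x.fst⟩ := rfl
  rw [Equiv.Perm.mul_apply, Equiv.Perm.mul_apply, hinv, hval, hα, hαx, hα']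
  ext
  · simp
  · simp only [snd_mul, map_add, hq', comm']; abel

/-- A group acting faithfully on `Z`, commuting with every automorphism of `Z` that comes from an
automorphism of the extension, embeds into `T` of the extension. -/
theorem exists_injective_hom_TGroup {H : Type*} [Group H] [DistribMulAction H Z] [FaithfulSMul H Z]
    (alt : ∀ v, β v v = 0) (two : ∀ z : Z, z + z = 0 → z = 0)
    (nondeg : ∀ v, (∀ w, β v w = 0) → v = 0)
    (span : ∀ f : Z →+ Z, (∀ v w, f (β v w) = 0) → f = 0)
    (comm : ∀ (g : V ≃+ V) (k : Z ≃+ Z), (∀ v w, k (β v w) = β (g v) (g w)) →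
      ∀ (h : H) (z : Z), k (h • z) = h • k z) :
    ∃ f : H →* TGroup (BiaddExt β), Function.Injective f := by
  let φ (h : H) : Z ≃+ Z := DistribMulAction.toAddEquiv Z h
  let ψ : H →* Equiv.Perm (BiaddExt β) :=
    { toFun h := permOfAddEquiv (φ h)
      map_one' := by ext x <;> simp [permOfAddEquiv, φ]
      map_mul' a b := by ext x <;> simp [permOfAddEquiv, φ, mul_smul] }
  have hψ (h : H) : ψ h ∈ multipleHolomorph (BiaddExt β) := by
    refine Subgroup.mem_normalizer_iff.2 fun σ => ⟨fun hσ => ?_, fun hσ => ?_⟩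
    · exact conj_mem_holomorph alt two nondeg _ (fun g k hgk => comm g k hgk h) hσ
    · have : ψ h⁻¹ * _ * (ψ h⁻¹)⁻¹ ∈ holomorph (BiaddExt β) :=
        conj_mem_holomorph alt two nondeg _ (fun g k hgk => comm g k hgk h⁻¹) hσ
      simpa [mul_assoc] using this
  refine ⟨(QuotientGroup.mk' _).comp (ψ.codRestrict _ hψ), ?_⟩
  rw [injective_iff_map_eq_one]
  intro h hh
  have hmem : ψ h ∈ holomorph (BiaddExt β) := by
    simpa [Subgroup.mem_subgroupOf] using (QuotientGroup.eq_one_iff _).1 hh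
  obtain ⟨α, y, hα⟩ := (mem_holomorph_iff _).1 hmem
  have hy : y = 1 := by
    have h1 := hα 1
    rw [α.map_one, one_mul] at h1
    rw [← h1]
    ext
    · rfl
    · exact smul_zero h
  subst hy
  have hval (x : BiaddExt β) : α x = ⟨x.fst, h • x.snd⟩ := by rw [← mul_one (α x), ← hα]; rfl
  -- An automorphism that is the identity on `V` must fix the values of `β`.
  have fix (v w : V) : h • β v w = β v w := by
    have := congrArg snd (map_mul α ⟨v, 0⟩ ⟨w, 0⟩)
    simpa [hval] using this
  have h0 := span ((φ h).toAddMonoidHom - AddMonoidHom.id Z) fun v w => by simp [φ, fix]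
  refine FaithfulSMul.eq_of_smul_eq_smul (α := Z) fun z => ?_
  simpa [φ, sub_eq_zero] using DFunLike.congr_fun h0 z

end BiaddExt

/-! ### Orthogonal sums of symplectic planes labelled by a frame -/

namespace BlockForm

open Finset

variable {p : ℕ} {J S : Type*} [DecidableEq J] [Fintype S]

/-- The standard basis of `J → ZMod p` together with the all-ones vector. -/
def frame (p : ℕ) : Option J → J → ZMod p
  | none => 1
  | some j => Pi.single j 1

/-- The symplectic form on the plane. -/
def planeForm (a b : ZMod p × ZMod p) : ZMod p := a.1 * b.2 - a.2 * b.1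

/-- The alternating map which is, on the plane with index `s`, the symplectic form times the frame
vector with label `c s`. -/
def blockForm (p : ℕ) (c : S → Option J) :
    (S → ZMod p × ZMod p) →+ (S → ZMod p × ZMod p) →+ (J → ZMod p) :=
  AddMonoidHom.mk' (fun v => AddMonoidHom.mk' (fun w => ∑ s, planeForm (v s) (w s) • frame p (c s))
    fun w w' => by
      rw [← sum_add_distrib]
      refine sum_congr rfl fun s _ => ?_
      rw [← add_smul]
      congr 1
      simp only [planeForm, Pi.add_apply, Prod.fst_add, Prod.snd_add]
      ring)
    fun v v' => by
      refine AddMonoidHom.ext fun w => ?_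
      simp only [AddMonoidHom.mk'_apply, AddMonoidHom.add_apply]
      rw [← sum_add_distrib]
      refine sum_congr rfl fun s _ => ?_
      rw [← add_smul]
      congr 1
      simp only [planeForm, Pi.add_apply, Prod.fst_add, Prod.snd_add]
      ring

theorem blockForm_apply (c : S → Option J) (v w : S → ZMod p × ZMod p) :
    blockForm p c v w = ∑ s, planeForm (v s) (w s) • frame p (c s) := rfl

theorem blockForm_self (c : S → Option J) (v : S → ZMod p × ZMod p) : blockForm p c v v = 0 := by
  rw [blockForm_apply]
  refine sum_eq_zero fun s _ => ?_
  rw [planeForm, mul_comm, sub_self, zero_smul]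

theorem blockForm_single [DecidableEq S] (c : S → Option J) (v : S → ZMod p × ZMod p) (s : S)
    (a : ZMod p × ZMod p) :
    blockForm p c v (Pi.single s a) = planeForm (v s) a • frame p (c s) := by
  rw [blockForm_apply, sum_eq_single s]
  · simp
  · intro t _ ht
    simp [ht, planeForm]
  · simp

theorem planeForm_nondegenerate {a : ZMod p × ZMod p} (h1 : planeForm a (0, 1) = 0)
    (h2 : planeForm a (1, 0) = 0) : a = 0 := by
  ext
  · simpa [planeForm] using h1
  · simpa [planeForm] using h2

variable [Fact p.Prime]

theorem frame_ne_zero [Nonempty J] (i : Option J) : frame p i ≠ 0 := by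
  cases i with
  | none => exact one_ne_zero
  | some j => simp [frame]

/-- The planes are mutually orthogonal, and each is nondegenerate unless `f` kills its label. -/
theorem radical_iff [DecidableEq S] (c : S → Option J) (f : (J → ZMod p) →ₗ[ZMod p] ZMod p)
    (v : S → ZMod p × ZMod p) :
    (∀ w, f (blockForm p c v w) = 0) ↔ ∀ s, f (frame p (c s)) ≠ 0 → v s = 0 := by
  constructor
  · intro h s hs
    have h' (a) : planeForm (v s) a = 0 := by
      simpa [blockForm_single, hs] using h (Pi.single s a)
    exact planeForm_nondegenerate (h' _) (h' _)
  · intro h w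
    rw [blockForm_apply, map_sum]
    refine sum_eq_zero fun s _ => ?_
    by_cases hs : f (frame p (c s)) = 0
    · simp [hs]
    · simp [h s hs, planeForm]

theorem natCard_radical [DecidableEq S] (c : S → Option J) (f : (J → ZMod p) →ₗ[ZMod p] ZMod p) :
    Nat.card {v // ∀ w, f (blockForm p c v w) = 0} =
      (p * p) ^ #{s | f (frame p (c s)) = 0} := by
  classical
  have : ∀ v, (∀ w, f (blockForm p c v w) = 0) ↔ v ∈ Fintype.piFinset
      fun s => if f (frame p (c s)) = 0 then univ else {(0 : ZMod p × ZMod p)} := by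
    intro v
    rw [radical_iff, Fintype.mem_piFinset]
    refine forall_congr' fun s => ?_
    split_ifs with h <;> simp [h]
  rw [Nat.card_congr (Equiv.subtypeEquivRight this), Nat.card_eq_fintype_card, Fintype.card_coe,
    Fintype.card_piFinset]
  simp only [apply_ite card, card_univ, Fintype.card_prod, ZMod.card, card_singleton]
  rw [prod_ite, prod_const, prod_const_one, mul_one]

/-- The labelling `c` is separating if a set of labels is determined by the number of its
preimages. -/
def Separating (c : S → Option J) : Prop :=
  ∀ A B : Finset (Option J), #{s | c s ∈ A} = #{s | c s ∈ B} → A = B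

/-- A label without preimages could not be told from the empty set. -/
theorem Separating.surjective {c : S → Option J} (hc : Separating c) : c.Surjective := by
  intro i
  by_contra! h
  have := hc {i} ∅ (by simp [h])
  simp at this

theorem blockForm_nondegenerate [DecidableEq S] [Nonempty J] (c : S → Option J) (v : S → ZMod p × ZMod p)
    (h : ∀ w, blockForm p c v w = 0) : v = 0 := by
  ext1 s
  have h' (a) : planeForm (v s) a = 0 := by
    simpa [blockForm_single, frame_ne_zero] using h (Pi.single s a)
  exact planeForm_nondegenerate (h' _) (h' _)

theorem addMonoidHom_apply_eq_sum [Fintype J] (f : (J → ZMod p) →+ (J → ZMod p)) (z : J → ZMod p) :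
    f z = ∑ j, z j • f (frame p (some j)) := by
  conv_lhs => rw [← univ_sum_single z, map_sum]
  refine sum_congr rfl fun j _ => ?_
  rw [← ZMod.map_smul f]
  congr 1
  ext i
  by_cases h : i = j
  · subst h; simp [frame]
  · simp [frame, h]

theorem blockForm_span [DecidableEq S] [Fintype J] {c : S → Option J} (hc : Separating c)
    (f : (J → ZMod p) →+ (J → ZMod p)) (h : ∀ v w, f (blockForm p c v w) = 0) : f = 0 := by
  refine AddMonoidHom.ext fun z => ?_
  rw [addMonoidHom_apply_eq_sum]
  refine sum_eq_zero fun j _ => ?_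
  obtain ⟨s, hs⟩ := hc.surjective (some j)
  have := h (Pi.single s (1, 0)) (Pi.single s (0, 1))
  simp only [blockForm_single, Pi.single_eq_same, planeForm, hs] at this
  simp only [mul_one, mul_zero, sub_zero, one_smul] at this
  rw [this, smul_zero]

theorem exists_smul_of_blockForm_comp [DecidableEq S] [Fintype J] {c : S → Option J} (hc : Separating c)
    (g : (S → ZMod p × ZMod p) ≃+ (S → ZMod p × ZMod p)) (k : (J → ZMod p) ≃+ (J → ZMod p))
    (h : ∀ v w, k (blockForm p c v w) = blockForm p c (g v) (g w)) :
    ∃ a : ZMod p, ∀ z, k z = a • z := by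
  let K : (J → ZMod p) →ₗ[ZMod p] (J → ZMod p) := k.toAddMonoidHom.toZModLinearMap p
  have hK (z) : K z = k z := rfl
  have key (f : (J → ZMod p) →ₗ[ZMod p] ZMod p) (i : Option J) (hi : f (frame p i) = 0) :
      f (k (frame p i)) = 0 := by
    -- `g` carries the radical of `f ∘ k ∘ β` onto that of `f ∘ β`; equal sizes mean equally many
    -- killed planes.
    have e : {v // ∀ w, (f ∘ₗ K) (blockForm p c v w) = 0} ≃
        {v // ∀ w, f (blockForm p c v w) = 0} := by
      refine g.toEquiv.subtypeEquiv fun v => ?_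
      simp only [LinearMap.comp_apply, hK, h]
      exact ⟨fun H w => by simpa using H (g.symm w), fun H w => H (g w)⟩
    have hcard := Nat.card_congr e
    have hp : 1 < p * p := Nat.one_lt_mul_iff.2 ⟨(Fact.out : p.Prime).pos,
      (Fact.out : p.Prime).pos, .inl (Fact.out : p.Prime).one_lt⟩
    rw [natCard_radical, natCard_radical] at hcard
    have hcard := Nat.pow_right_injective hp hcard
    have := hc {i | (f ∘ₗ K) (frame p i) = 0} {i | f (frame p i) = 0} (by simpa using hcard)
    have := (Finset.ext_iff.1 this i).2 (by simpa using hi)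
    simpa [hK] using this
  -- Coordinate functionals make `k` diagonal; differences of coordinates then make its diagonal
  -- constant.
  have hoff (i j : J) (hij : i ≠ j) : k (frame p (some j)) i = 0 :=
    key (LinearMap.proj i) (some j) (by simp [frame, hij])
  have hones (i j : J) : k (frame p none) i = k (frame p none) j := by
    let D : (J → ZMod p) →ₗ[ZMod p] ZMod p :=
      (LinearMap.proj i : (J → ZMod p) →ₗ[ZMod p] ZMod p) - LinearMap.proj j
    have hD (z : J → ZMod p) : D z = z i - z j := rfl
    have := key D none (by simp [hD, frame])
    rwa [hD, sub_eq_zero] at this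
  have happ (z : J → ZMod p) (i : J) : k z i = z i * k (frame p (some i)) i := by
    have := congrFun (addMonoidHom_apply_eq_sum k.toAddMonoidHom z) i
    rw [Finset.sum_apply, sum_eq_single i] at this
    · simpa using this
    · intro j _ hj
      simp [hoff i j hj.symm]
    · simp
  have hdiag (i : J) : k (frame p none) i = k (frame p (some i)) i := by
    rw [happ]; simp [frame]
  rcases isEmpty_or_nonempty J with hJ | ⟨⟨j⟩⟩
  · exact ⟨0, fun z => Subsingleton.elim _ _⟩
  · refine ⟨k (frame p none) j, fun z => ?_⟩
    ext i
    rw [happ, ← hdiag, hones i j, Pi.smul_apply, smul_eq_mul, mul_comm]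

omit [DecidableEq J] in
theorem add_self_eq_zero (hp : Odd p) (z : J → ZMod p) (h : z + z = 0) : z = 0 := by
  have h2 : (2 : ZMod p) ≠ 0 := by
    have : ((2 : ℕ) : ZMod p) ≠ 0 := by
      rw [Ne, ZMod.natCast_eq_zero_iff, Nat.prime_dvd_prime_iff_eq Fact.out Nat.prime_two]
      rintro rfl
      exact absurd hp (by decide)
    exact_mod_cast this
  ext j
  have := congrFun h j
  rw [Pi.add_apply, ← two_mul] at this
  exact (mul_eq_zero.1 this).resolve_left h2

theorem exists_group (hp : Odd p) {J S : Type} [Fintype J] [DecidableEq J] [Fintype S]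
    [DecidableEq S] [Nonempty J] {c : S → Option J} (hc : Separating c)
    {H : Type*} [Group H] (φ : H →* Equiv.Perm J) (hφ : Function.Injective φ) :
    ∃ (G : Type) (_ : Group G) (_ : Finite G) (_ : Group.IsNilpotent G),
        IsPGroup p G ∧ Group.nilpotencyClass G = 2 ∧
        Nat.card G = p ^ (2 * Fintype.card S + Fintype.card J) ∧
        ∃ f : H →* TGroup G, Function.Injective f := by
  have alt := blockForm_self (p := p) c
  have two := add_self_eq_zero (J := J) hp
  have nondeg := blockForm_nondegenerate (p := p) c
  have nil := BiaddExt.isNilpotent alt two nondeg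
  have : Nonempty S := ⟨(hc.surjective none).choose⟩
  have hcard : Nat.card (BiaddExt (blockForm p c)) =
      p ^ (2 * Fintype.card S + Fintype.card J) := by
    rw [BiaddExt.natCard_eq]
    simp [pow_add, pow_mul, ← sq]
  -- The inverse makes the permutation of coordinates a left action.
  let _ : DistribMulAction H (J → ZMod p) :=
    { smul h z := fun j => z (φ h⁻¹ j)
      one_smul z := by ext j; change z (φ 1⁻¹ j) = z j; simp
      mul_smul a b z := by
        ext j
        change z (φ (a * b)⁻¹ j) = z (φ b⁻¹ (φ a⁻¹ j))
        simp
      smul_zero _ := rfl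
      smul_add _ _ _ := rfl }
  have smul_apply (h : H) (z : J → ZMod p) (j : J) : (h • z) j = z (φ h⁻¹ j) := rfl
  have : FaithfulSMul H (J → ZMod p) := by
    refine ⟨fun {a b} hab => ?_⟩
    rw [← inv_inj]
    apply hφ
    ext j
    have := congrFun (hab (Pi.single (φ a⁻¹ j) 1)) j
    rw [smul_apply, smul_apply, Pi.single_eq_same] at this
    by_contra hne
    rw [Pi.single_eq_of_ne (Ne.symm hne)] at this
    exact one_ne_zero this
  refine ⟨BiaddExt (blockForm p c), inferInstance, inferInstance, nil, IsPGroup.of_card hcard,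
    BiaddExt.nilpotencyClass_eq_two alt two nondeg, hcard,
    BiaddExt.exists_injective_hom_TGroup alt two nondeg (blockForm_span hc) ?_⟩
  intro g k hgk h z
  obtain ⟨a, ha⟩ := exists_smul_of_blockForm_comp hc g k hgk
  rw [ha, ha]
  rfl

/-! ### Block sizes with distinct subset sums -/

/-- Blocks of sizes `1, 2, …, 2 ^ (z - 1)` and `R`. -/
def blockSize (z R : ℕ) : Option (Fin z) → ℕ
  | none => R
  | some j => 2 ^ (j : ℕ)

theorem sum_two_pow_fin_eq {z : ℕ} (P : Fin z → Prop) [DecidablePred P] :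
    ∑ j, (if P j then 2 ^ (j : ℕ) else 0) =
      ∑ k ∈ ({j | P j} : Finset (Fin z)).map Fin.valEmbedding, 2 ^ k := by
  rw [sum_map, sum_filter]; rfl

/-- Binary expansions are unique, and the powers of two add up to less than `2 ^ z ≤ R`, so the
total also shows whether the block of size `R` is used. -/
theorem separating_blockSize {z R : ℕ} (hR : 2 ^ z ≤ R) :
    Separating (Sigma.fst : (Σ i, Fin (blockSize z R i)) → Option (Fin z)) := by
  have hcard (A : Finset (Option (Fin z))) :
      #{s : Σ i, Fin (blockSize z R i) | s.1 ∈ A} =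
        (if none ∈ A then R else 0) +
          ∑ k ∈ ({j | some j ∈ A} : Finset (Fin z)).map Fin.valEmbedding, 2 ^ k := by
    have : ({s : Σ i, Fin (blockSize z R i) | s.1 ∈ A} : Finset _) = A.sigma fun _ => univ := by
      ext s; simp
    rw [this, card_sigma, ← sum_two_pow_fin_eq, ← Fintype.sum_ite_mem, Fintype.sum_option]
    simp only [card_univ, Fintype.card_fin]
    rfl
  have hlt (A : Finset (Option (Fin z))) :
      ∑ k ∈ ({j | some j ∈ A} : Finset (Fin z)).map Fin.valEmbedding, 2 ^ k < 2 ^ z := by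
    refine Nat.geomSum_lt le_rfl fun k hk => ?_
    obtain ⟨j, -, rfl⟩ := mem_map.1 hk
    exact j.2
  intro A B hAB
  rw [hcard, hcard] at hAB
  have hA := hlt A
  have hB := hlt B
  have hnone : none ∈ A ↔ none ∈ B := by
    by_cases h1 : none ∈ A <;> by_cases h2 : none ∈ B <;>
      simp only [h1, h2, if_true, if_false] at hAB ⊢ <;> omega
  simp only [hnone, add_right_inj] at hAB
  have h := map_injective _ (geomSum_injective le_rfl hAB)
  ext (_ | j)
  · exact hnone
  · simpa using Finset.ext_iff.1 h j

theorem card_blocks (z R : ℕ) : Fintype.card (Σ i, Fin (blockSize z R i)) = R + (2 ^ z - 1) := by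
  rw [Fintype.card_sigma, Fintype.sum_option]
  simp only [Fintype.card_fin]
  rw [blockSize.eq_def]
  simp only [blockSize]
  rw [Fin.sum_univ_eq_sum_range (fun k => 2 ^ k), Nat.geomSum_eq le_rfl]
  simp

end BlockForm

theorem mainTheorem2 (p : ℕ) (hp : p.Prime) (hp2 : Odd p)
    {H : Type*} [Group H] [Finite H] :
    ∃ N : ℕ, ∀ n : ℕ, N ≤ n →
      ∃ (G : Type) (_ : Group G) (_ : Finite G) (_ : Group.IsNilpotent G),
        IsPGroup p G ∧ Group.nilpotencyClass G = 2 ∧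
        Nat.card G = p ^ (n + n.choose 2) ∧
        ∃ f : H →* TGroup G, Function.Injective f := by
  have : Fact p.Prime := ⟨hp⟩
  have hH : 0 < Nat.card H := Nat.card_pos
  -- The bound leaves room for `R ≥ 2 ^ z` for either choice of `z`. The exponent is `2 * (R + 2 ^ z
  -- - 1) + z`, so `z` must have its parity.
  refine ⟨4 * 2 ^ (Nat.card H + 1) + (Nat.card H + 1), fun n hn => ?_⟩
  obtain ⟨z, hz, hzle, hpar⟩ : ∃ z, Nat.card H ≤ z ∧ z ≤ Nat.card H + 1 ∧
      (n + n.choose 2) % 2 = z % 2 := by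
    rcases Nat.mod_two_eq_zero_or_one (n + n.choose 2 + Nat.card H) with h | h
    · exact ⟨Nat.card H, le_rfl, by omega, by omega⟩
    · exact ⟨Nat.card H + 1, by omega, le_rfl, by omega⟩
  have hpow : 2 ^ z ≤ 2 ^ (Nat.card H + 1) := Nat.pow_le_pow_right two_pos hzle
  have hpos : 0 < 2 ^ z := by positivity
  obtain ⟨R, hR, hcard⟩ : ∃ R, 2 ^ z ≤ R ∧ 2 * (R + (2 ^ z - 1)) + z = n + n.choose 2 :=
    ⟨(n + n.choose 2 - z) / 2 - (2 ^ z - 1), by omega, by omega⟩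
  have : Nonempty (Fin z) := ⟨⟨0, by omega⟩⟩
  -- Cayley's embedding of `H`, extended by fixed points to `z` letters.
  let e : H ↪ Fin z := (Finite.equivFin H).toEmbedding.trans (Fin.castLEEmb hz)
  have := BlockForm.exists_group hp2 (BlockForm.separating_blockSize hR)
    ((Equiv.Perm.viaEmbeddingHom e).comp (MulAction.toPermHom H H))
    ((Equiv.Perm.viaEmbeddingHom_injective e).comp MulAction.toPerm_injective)
  rwa [BlockForm.card_blocks, Fintype.card_fin, hcard] at this
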